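/- Let $\mathbb D$ be the open unit disc in $\mathbb C$ and let $\sigma_n=(\sigma_{n,1},\dots,\sigma_{n,n}):\mathbb C^n\to\mathbb C^n$ be given by $$\sigma_{n,k}(z_1,\dots,z_n)=\sum_{1\le j_1<\dots<j_k\le n}z_{j_1}\cdots z_{j_k},\qquad 1\le k\le n.$$ For every $n\ge 3$, the symmetrized $n$-disc $\mathbb G_n=\sigma_n(\mathbb D^n)$ cannot be exhausted by domains biholomorphic to convex domains. That is, it is not true that for every compact set $K\subset\mathbb G_n$ there is a domain $D'$ with $K\subset D'\subset\mathbb G_n$ that is biholomorphic to a convex domain in $\mathbb C^n$. -/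

import Mathlib

/-- The symmetrization map `σ_n : ℂⁿ → ℂⁿ`. Its coordinate with index `k : Fin n` (so `k = 0, …, n - 1`)
is the elementary symmetric polynomial of degree `k + 1`. -/
def symmetrization (n : ℕ) (z : Fin n → ℂ) : Fin n → ℂ :=
  fun k => ∑ s ∈ Finset.powersetCard (k.val + 1) (Finset.univ : Finset (Fin n)), ∏ i ∈ s, z i

/-- The unit polydisc `𝔻ⁿ`, where `𝔻` is the open unit disc in `ℂ`. -/
def unitPolydisc (n : ℕ) : Set (Fin n → ℂ) :=
  {z | ∀ i, z i ∈ Metric.ball (0 : ℂ) 1}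

/-- The symmetrized `n`-disc `𝔾_n = σ_n(𝔻ⁿ)`. -/
def symmetrizedDisc (n : ℕ) : Set (Fin n → ℂ) :=
  symmetrization n '' unitPolydisc n

/-- A domain in `ℂⁿ`: a non-empty connected open set. -/
def IsDomainSet {n : ℕ} (D : Set (Fin n → ℂ)) : Prop :=
  IsOpen D ∧ IsConnected D

/-- Two subsets (in the applications, domains) of `ℂⁿ` are biholomorphic: there are mutually inverse
holomorphic maps between them. -/
def Biholomorphic {n : ℕ} (U V : Set (Fin n → ℂ)) : Prop :=
  ∃ f g : (Fin n → ℂ) → (Fin n → ℂ),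
    DifferentiableOn ℂ f U ∧ DifferentiableOn ℂ g V ∧
    Set.MapsTo f U V ∧ Set.MapsTo g V U ∧ Set.InvOn g f U V

/-- `D` can be exhausted by domains biholomorphic to convex domains: every compact subset of `D` is
contained in a domain `D' ⊆ D` which is biholomorphic to a convex domain in `ℂⁿ`. -/
def ExhaustedByBiholomorphicToConvex {n : ℕ} (D : Set (Fin n → ℂ)) : Prop :=
  ∀ K : Set (Fin n → ℂ), IsCompact K → K ⊆ D →
    ∃ D' : Set (Fin n → ℂ), IsDomainSet D' ∧ K ⊆ D' ∧ D' ⊆ D ∧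
      ∃ G : Set (Fin n → ℂ), IsDomainSet G ∧ Convex ℝ G ∧ Biholomorphic D' G

open Filter Topology Metric Asymptotics Set

/-! The slice of `𝔾_n` where all coordinates of weight at most `n/2` vanish would have to be convex,
and it is not. Convexity (`convex_slice_of_exhausted`): for `a`, `b` in the slice, some `D'` with a
convex model contains the discs `l ↦ weightedDilation l a` and `l ↦ weightedDilation l b`. Combine
them in the model and pull back. Both discs vanish to order greater than `n/2`, so the quadratic
errors are `O(l^(n+1))`, and the new disc agrees with the dilations of `s = α a + β b` to order `n`.
Undoing the dilation gives a holomorphic `h` with `h 0 = s` whose dilations over the unit circle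
stay in `𝔾_n`; a zero-counting homotopy then puts `s` in `𝔾_n`. Non-convexity
(`not_convex_zeroFreeTrinomials`): for `n ≥ 3` the slice contains the points given by zero-free
trinomials `1 + A t^(n-1) + B t^n`. Convexity would force these to have nonnegative real part on the
unit circle, which fails at a smallest zero of a suitable trinomial. -/

/-! ### Schwarz-type estimates and persistence of zero-freeness -/

theorem exists_clm_sub_isBigO_sq {E F : Type*} [NormedAddCommGroup E] [NormedSpace ℂ E]
    [NormedAddCommGroup F] [NormedSpace ℂ F] {f : E → F} {c : E}
    (hf : ∀ᶠ x in 𝓝 c, DifferentiableAt ℂ f x) :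
    ∃ L : E →L[ℂ] F, (fun x => f x - f c - L (x - c)) =O[𝓝 c] fun x => ‖x - c‖ ^ 2 := by
  set L := fderiv ℂ f c
  refine ⟨L, ?_⟩
  set φ : E → F := fun x => f x - L (x - c) with hφ
  have hφc : φ c = f c := by simp [hφ]
  have hd : ∀ᶠ x in 𝓝 c, DifferentiableAt ℂ φ x := by
    filter_upwards [hf] with x hx
    exact hx.sub (L.differentiableAt.comp x (differentiableAt_id.sub_const c))
  have hcont : ∀ᶠ x in 𝓝 c, φ x ∈ closedBall (φ c) 1 :=
    hd.self_of_nhds.continuousAt.eventually_mem (closedBall_mem_nhds _ one_pos)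
  obtain ⟨r, hr, hball⟩ := Metric.eventually_nhds_iff_ball.1 (hd.and hcont)
  have ho : (fun x => φ x - φ c) =o[𝓝 c] fun x => ‖x - c‖ ^ 1 := by
    have := hf.self_of_nhds.hasFDerivAt.isLittleO
    simp only [pow_one]
    refine (this.norm_right).congr_left fun x => ?_
    simp only [hφ, sub_self, map_zero, sub_zero, L]
    abel
  refine IsBigO.of_bound (1 / r ^ 2) ?_
  filter_upwards [ball_mem_nhds c hr] with x hx
  -- Higher-order Schwarz lemma: the bounded map `φ` has no linear term at `c`, so it is
  -- quadratically small.
  have := Complex.dist_le_mul_div_pow_of_mapsTo_ball_of_isLittleO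
    (fun y hy => (hball y hy).1.differentiableWithinAt) (fun y hy => (hball y hy).2) ho hx
  rw [dist_eq_norm, dist_eq_norm, hφc] at this
  simp only [hφ] at this
  rw [norm_pow, norm_norm, show f x - f c - L (x - c) = f x - L (x - c) - f c by abel]
  refine this.trans_eq ?_
  rw [div_pow]
  ring

theorem isBigO_sub_of_differentiable {ι E F : Type*} [NormedAddCommGroup E] [NormedSpace ℂ E]
    [NormedAddCommGroup F] [NormedSpace ℂ F] {g : E → F} {c : E}
    (hg : ∀ᶠ x in 𝓝 c, DifferentiableAt ℂ g x) {l : Filter ι} {u v : ι → E}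
    (hu : Tendsto u l (𝓝 c)) (hv : Tendsto v l (𝓝 c)) :
    (fun i => g (u i) - g (v i)) =O[l] fun i => u i - v i := by
  have hcont : ∀ᶠ x in 𝓝 c, g x ∈ ball (g c) 1 :=
    hg.self_of_nhds.continuousAt.eventually_mem (ball_mem_nhds _ one_pos)
  obtain ⟨r, hr, hball⟩ := Metric.eventually_nhds_iff_ball.1 (hg.and hcont)
  refine IsBigO.of_bound (2 / (r / 2)) ?_
  filter_upwards [hu (ball_mem_nhds c (show 0 < r / 4 by positivity)),
    hv (ball_mem_nhds c (show 0 < r / 4 by positivity))] with i hui hvi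
  have hui : dist (u i) c < r / 4 := hui
  have hvi : dist (v i) c < r / 4 := hvi
  have hsub : ∀ y ∈ ball (v i) (r / 2), y ∈ ball c r := fun y hy => by
    rw [mem_ball] at *
    linarith [dist_triangle y (v i) c]
  rw [← dist_eq_norm, ← dist_eq_norm]
  refine Complex.dist_le_div_mul_dist_of_mapsTo_ball
    (fun y hy => (hball y (hsub y hy)).1.differentiableWithinAt) (fun y hy => ?_) ?_
  · have h1 := (hball y (hsub y hy)).2
    have h2 := (hball (v i) (hsub _ (mem_ball_self (by positivity)))).2
    rw [mem_ball] at h1 h2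
    rw [mem_closedBall]
    linarith [dist_triangle_right (g y) (g (v i)) (g c)]
  · rw [mem_ball]
    linarith [dist_triangle_right (u i) (v i) c]

/-- If holomorphic functions depending continuously on a real parameter have no zeros on a circle, and
the first one has no zeros in the closed disc, then none of them has. -/
theorem ne_zero_of_homotopy {F : ℝ → ℂ → ℂ} {r : ℝ}
    (hcont : ContinuousOn (Function.uncurry F) (Icc 0 1 ×ˢ closedBall 0 r))
    (hdiff : ∀ σ ∈ Icc (0 : ℝ) 1, DifferentiableOn ℂ (F σ) (closedBall 0 r))
    (hzero : ∀ z ∈ closedBall (0 : ℂ) r, F 0 z ≠ 0)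
    (hsphere : ∀ σ ∈ Icc (0 : ℝ) 1, ∀ z ∈ sphere (0 : ℂ) r, F σ z ≠ 0)
    (hr : 0 < r) {σ : ℝ} (hσ : σ ∈ Icc (0 : ℝ) 1) {z : ℂ} (hz : z ∈ closedBall (0 : ℂ) r) :
    F σ z ≠ 0 := by
  intro hbad
  set S : Set (ℝ × ℂ) := Icc 0 1 ×ˢ closedBall 0 r
  have hS : IsCompact S := isCompact_Icc.prod (isCompact_closedBall 0 r)
  have hZ : IsCompact (S ∩ Function.uncurry F ⁻¹' {0}) :=
    hS.of_isClosed_subset (hcont.preimage_isClosed_of_isClosed hS.isClosed isClosed_singleton)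
      inter_subset_left
  -- Take the first parameter `σ₀` with a zero. Before it, the maximum principle for `1 / F τ`
  -- bounds `‖F τ z₀‖` below by the minimum `c` over the circles, and the bound survives the limit
  -- `τ → σ₀`.
  obtain ⟨⟨σ₀, z₀⟩, ⟨⟨hσ₀, hz₀⟩, hF₀⟩, hmin⟩ :=
    hZ.exists_isMinOn ⟨(σ, z), ⟨hσ, hz⟩, hbad⟩ continuousOn_fst
  replace hF₀ : F σ₀ z₀ = 0 := hF₀
  replace hσ₀ : σ₀ ∈ Icc (0 : ℝ) 1 := hσ₀
  replace hz₀ : z₀ ∈ closedBall (0 : ℂ) r := hz₀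
  have hpos : 0 < σ₀ := by
    refine lt_of_le_of_ne hσ₀.1 fun h => ?_
    rw [← h] at hF₀
    exact hzero z₀ hz₀ hF₀
  have hne : ∀ τ, 0 ≤ τ → τ < σ₀ → ∀ w ∈ closedBall (0 : ℂ) r, F τ w ≠ 0 := by
    intro τ hτ hτσ w hw h0
    have : σ₀ ≤ τ := hmin (a := (τ, w)) ⟨⟨⟨hτ, hτσ.le.trans hσ₀.2⟩, hw⟩, h0⟩
    linarith
  have hT : IsCompact (Icc (0 : ℝ) 1 ×ˢ sphere (0 : ℂ) r) := isCompact_Icc.prod (isCompact_sphere 0 r)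
  obtain ⟨⟨σ₁, z₁⟩, ⟨hσ₁, hz₁⟩, hmin₁⟩ := hT.exists_isMinOn
    ⟨(0, (r : ℂ)), ⟨by simp, by simp [abs_of_pos hr]⟩⟩
    (hcont.norm.mono (prod_mono_right sphere_subset_closedBall))
  set c := ‖F σ₁ z₁‖
  have hc : 0 < c := norm_pos_iff.2 (hsphere _ hσ₁ _ hz₁)
  have hlow : ∀ τ, 0 ≤ τ → τ < σ₀ → c ≤ ‖F τ z₀‖ := by
    intro τ hτ hτσ
    have hτ1 : τ ∈ Icc (0 : ℝ) 1 := ⟨hτ, hτσ.le.trans hσ₀.2⟩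
    have hd : DifferentiableOn ℂ (fun w => (F τ w)⁻¹) (closure (ball 0 r)) := by
      rw [closure_ball _ hr.ne']
      exact (hdiff τ hτ1).inv (hne τ hτ hτσ)
    have := Complex.norm_le_of_forall_mem_frontier_norm_le isBounded_ball hd.diffContOnCl
      (C := c⁻¹) (fun w hw => ?_) (by rwa [closure_ball _ hr.ne'] : z₀ ∈ closure (ball 0 r))
    · rw [norm_inv] at this
      exact (inv_le_inv₀ (norm_pos_iff.2 (hne τ hτ hτσ z₀ hz₀)) hc).1 this
    · rw [frontier_ball _ hr.ne'] at hw
      rw [norm_inv]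
      exact inv_anti₀ hc (hmin₁ (a := (τ, w)) ⟨hτ1, hw⟩)
  have hlim : Tendsto (fun τ => ‖F τ z₀‖) (𝓝[Ico 0 σ₀] σ₀) (𝓝 ‖F σ₀ z₀‖) := by
    have h1 : ContinuousOn (fun τ => F τ z₀) (Icc 0 1) :=
      hcont.comp (f := fun τ : ℝ => (τ, z₀)) (by fun_prop) fun τ hτ => ⟨hτ, hz₀⟩
    exact ((h1 σ₀ hσ₀).mono fun τ hτ => ⟨hτ.1, hτ.2.le.trans hσ₀.2⟩).norm
  have : (𝓝[Ico 0 σ₀] σ₀).NeBot := by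
    rw [← mem_closure_iff_nhdsWithin_neBot, closure_Ico hpos.ne]
    exact right_mem_Icc.2 hpos.le
  have : c ≤ ‖F σ₀ z₀‖ := ge_of_tendsto hlim (by
    filter_upwards [self_mem_nhdsWithin] with τ hτ using hlow τ hτ.1 hτ.2)
  rw [hF₀, norm_zero] at this
  linarith


/-! ### Non-convexity of the zero-free trinomials -/

/-- The pairs of coefficients `(A, B)` for which `1 + A t ^ N + B t ^ (N + 1)` has no zeros in the
closed unit disc. -/
def zeroFreeTrinomials (N : ℕ) : Set (ℂ × ℂ) :=
  {p | ∀ t : ℂ, ‖t‖ ≤ 1 → 1 + p.1 * t ^ N + p.2 * t ^ (N + 1) ≠ 0}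

/-- If the value `v` at `e` had negative real part, a suitable convex combination with a binomial `1
+ a t^(N+1)`, `‖a‖ < 1`, would vanish at `e`. -/
theorem re_trinomial_nonneg {N : ℕ} (hconv : Convex ℝ (zeroFreeTrinomials N)) {A B e : ℂ}
    (hAB : (A, B) ∈ zeroFreeTrinomials N) (he : ‖e‖ = 1) :
    0 ≤ (1 + A * e ^ N + B * e ^ (N + 1)).re := by
  by_contra! hneg
  set v := 1 + A * e ^ N + B * e ^ (N + 1) with hv
  have hv0 : v ≠ 0 := fun h => by simp [h] at hneg
  have hnv : 0 < Complex.normSq v := Complex.normSq_pos.2 hv0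
  -- The minimizer of `‖1 + ε v‖` over real `ε`.
  set ε : ℝ := -v.re / Complex.normSq v with hε
  have hεpos : 0 < ε := div_pos (by linarith) hnv
  have hlt : ‖1 + ε * v‖ < 1 := by
    have h1 : Complex.normSq (1 + ε * v) = 1 - v.re ^ 2 / Complex.normSq v := by
      have : Complex.normSq (1 + ε * v) = 1 + 2 * ε * v.re + ε ^ 2 * Complex.normSq v := by
        simp only [Complex.normSq_apply, Complex.add_re, Complex.add_im, Complex.mul_re,
          Complex.mul_im, Complex.ofReal_re, Complex.ofReal_im, Complex.one_re, Complex.one_im]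
        ring
      rw [this, hε]
      field_simp
      ring
    have h2 : 0 < v.re ^ 2 / Complex.normSq v := div_pos (by nlinarith) hnv
    rw [Complex.normSq_eq_norm_sq] at h1
    nlinarith [norm_nonneg (1 + ε * v)]
  have he0 : e ≠ 0 := fun h => by simp [h] at he
  set a := -(1 + ε * v) / e ^ (N + 1) with ha
  have hamem : ((0 : ℂ), a) ∈ zeroFreeTrinomials N := by
    intro t ht h0
    simp only [zero_mul, add_zero] at h0
    have h1 : ‖a * t ^ (N + 1)‖ = 1 := by
      rw [show a * t ^ (N + 1) = -1 by linear_combination h0]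
      simp
    have h2 : ‖a‖ < 1 := by
      rw [ha, norm_div, norm_neg, norm_pow, he, one_pow, div_one]
      exact hlt
    rw [norm_mul, norm_pow] at h1
    have h3 : ‖t‖ ^ (N + 1) ≤ 1 := pow_le_one₀ (norm_nonneg _) ht
    nlinarith [norm_nonneg a, pow_nonneg (norm_nonneg t) (N + 1)]
  have hmem := hconv hAB hamem (a := ε / (1 + ε)) (b := 1 / (1 + ε)) (by positivity) (by positivity)
    (by field_simp; ring)
  refine hmem e he.le ?_
  have h1ε : (1 + ε : ℂ) ≠ 0 := by exact_mod_cast (by positivity : (1 + ε) ≠ 0)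
  simp only [Prod.smul_mk, Prod.mk_add_mk, Complex.real_smul, smul_zero, add_zero,
    Complex.ofReal_div, Complex.ofReal_add, Complex.ofReal_one]
  have hae : a * e ^ (N + 1) = -(1 + ε * v) := div_mul_cancel₀ _ (pow_ne_zero _ he0)
  field_simp
  linear_combination hae - (ε : ℂ) * hv

theorem not_convex_zeroFreeTrinomials {N : ℕ} (hN : 1 ≤ N) : ¬ Convex ℝ (zeroFreeTrinomials N) := by
  intro hconv
  -- With `A^(N+1) = i`, the terms `x = A t^N` and `y = t^(N+1)` satisfy `x^(N+1) = i y^N`, so for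
  -- `t ≠ 0` they cannot both be real.
  obtain ⟨A, hA⟩ := IsAlgClosed.exists_pow_nat_eq Complex.I N.succ_pos
  set Q : ℂ → ℂ := fun t => 1 + A * t ^ N + t ^ (N + 1) with hQ
  have hQc : Continuous Q := by fun_prop
  have hroot : ∃ t, Q t = 0 := by
    obtain ⟨t, ht⟩ := IsAlgClosed.exists_root
      (Polynomial.X ^ (N + 1) + (Polynomial.C A * Polynomial.X ^ N + 1) : Polynomial ℂ) (by
        rw [Polynomial.degree_add_eq_left_of_degree_lt]
        · simp; exact_mod_cast N.succ_ne_zero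
        · rw [Polynomial.degree_X_pow]
          refine (Polynomial.degree_add_le _ _).trans_lt (max_lt ?_ ?_)
          · exact (Polynomial.degree_C_mul_X_pow_le _ _).trans_lt (by exact_mod_cast N.lt_succ_self)
          · rw [Polynomial.degree_one]; exact_mod_cast N.succ_pos)
    refine ⟨t, ?_⟩
    simp only [Polynomial.IsRoot.def, Polynomial.eval_add, Polynomial.eval_pow, Polynomial.eval_X,
      Polynomial.eval_mul, Polynomial.eval_C, Polynomial.eval_one] at ht
    simp only [hQ]
    linear_combination ht
  obtain ⟨t₁, ht₁, hmin⟩ := (isClosed_singleton.preimage hQc : IsClosed (Q ⁻¹' {0})).exists_infDist_eq_dist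
    hroot 0
  replace ht₁ : Q t₁ = 0 := ht₁
  have hfree : ∀ t, ‖t‖ < ‖t₁‖ → Q t ≠ 0 := by
    intro t ht h0
    have := infDist_le_dist_of_mem (x := 0) (show t ∈ Q ⁻¹' {0} from h0)
    rw [hmin, dist_zero_left, dist_zero_left] at this
    linarith
  have ht₁0 : t₁ ≠ 0 := by
    rintro rfl
    simp [hQ, Nat.pos_iff_ne_zero.1 hN] at ht₁
  have hr : 0 < ‖t₁‖ := norm_pos_iff.2 ht₁0
  have hre : ∀ t ∈ ball (0 : ℂ) ‖t₁‖, 0 ≤ (Q t).re := by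
    intro t ht
    rw [mem_ball_zero_iff] at ht
    rcases eq_or_ne t 0 with rfl | ht0
    · simp [hQ, Nat.pos_iff_ne_zero.1 hN]
    · have hnt : (‖t‖ : ℂ) ≠ 0 := by simpa using ht0
      -- Rescaling by `‖t‖ < ‖t₁‖` makes `Q` zero-free on the closed unit disc.
      have hmem : (A * ‖t‖ ^ N, (‖t‖ : ℂ) ^ (N + 1)) ∈ zeroFreeTrinomials N := by
        intro s hs h0
        refine hfree (‖t‖ * s) ?_ ?_
        · rw [norm_mul, Complex.norm_real, norm_norm]
          nlinarith [norm_nonneg t]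
        · simp only [hQ, mul_pow]
          linear_combination h0
      have := re_trinomial_nonneg hconv hmem (e := t / ‖t‖) (by simp [ht0])
      rw [div_pow, div_pow] at this
      convert this using 2
      simp only [hQ]
      field_simp
  have hre' : ∀ t, ‖t‖ = ‖t₁‖ → 0 ≤ (Q t).re := by
    intro t ht
    have hcl : IsClosed {t | 0 ≤ (Q t).re} :=
      isClosed_le continuous_const (Complex.continuous_re.comp hQc)
    have := closure_minimal hre hcl
    rw [closure_ball _ hr.ne'] at this
    exact this (mem_closedBall_zero_iff.2 ht.le)
  set E : ℝ → ℂ := fun θ => t₁ * Complex.exp (θ * Complex.I) with hE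
  have hEd : HasDerivAt E (t₁ * Complex.I) 0 := by
    have h1 : HasDerivAt (fun θ : ℝ => (θ : ℂ) * Complex.I) (1 * Complex.I) 0 :=
      (Complex.ofRealCLM.hasDerivAt (x := (0 : ℝ))).mul_const Complex.I
    have := (h1.cexp).const_mul t₁
    simpa using this
  have hE0 : E 0 = t₁ := by simp [hE]
  have hQd : HasDerivAt (fun θ => Q (E θ))
      ((N * (A * t₁ ^ N) + (N + 1) * t₁ ^ (N + 1)) * Complex.I) 0 := by
    have := (((hEd.pow N).const_mul A).const_add 1).add (hEd.pow (N + 1))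
    rw [hE0] at this
    convert! this using 1
    obtain ⟨m, rfl⟩ := Nat.exists_eq_add_of_le' hN
    simp only [Nat.add_sub_cancel, Nat.cast_add, Nat.cast_one]
    ring
  have hQre : HasDerivAt (fun θ => (Q (E θ)).re)
      ((N * (A * t₁ ^ N) + (N + 1) * t₁ ^ (N + 1)) * Complex.I).re 0 :=
    Complex.reCLM.hasFDerivAt.comp_hasDerivAt (0 : ℝ) hQd
  -- On the circle through `t₁`, `Re Q` is nonnegative and vanishes at `t₁`. The zero angular
  -- derivative, together with `x + y = -1`, makes `x` and `y` real.
  have hext : IsLocalMin (fun θ => (Q (E θ)).re) 0 := by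
    refine Eventually.of_forall fun θ => ?_
    simp only [hE0, ht₁, Complex.zero_re]
    exact hre' _ (by simp [hE, Complex.norm_exp_ofReal_mul_I])
  have hder := hext.hasDerivAt_eq_zero hQre
  set x := A * t₁ ^ N with hx
  set y := t₁ ^ (N + 1) with hy
  have hxy : x.im = -y.im := by
    have := congrArg Complex.im ht₁
    simp only [hQ, ← hx, ← hy, Complex.add_im, Complex.one_im, Complex.zero_im] at this
    linarith
  have hder' : N * x.im + (N + 1) * y.im = 0 := by
    rw [Complex.mul_I_re, neg_eq_zero] at hder
    simpa using hder
  have hyim : y.im = 0 := by rw [hxy] at hder'; linarith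
  have hxim : x.im = 0 := by rw [hxy, hyim, neg_zero]
  have hyr : y = (y.re : ℂ) := Complex.ext (by simp) (by simp [hyim])
  have hxr : x = (x.re : ℂ) := Complex.ext (by simp) (by simp [hxim])
  have hkey : x ^ (N + 1) = Complex.I * y ^ N := by
    rw [← hA, hx, hy, mul_pow, ← pow_mul, ← pow_mul, mul_comm N]
  rw [hxr, hyr] at hkey
  have h0 := congrArg Complex.im hkey
  rw [← Complex.ofReal_pow, ← Complex.ofReal_pow, Complex.ofReal_im, Complex.I_mul_im,
    Complex.ofReal_re] at h0
  have : y.re = 0 := pow_eq_zero_iff (Nat.pos_iff_ne_zero.1 hN) |>.1 h0.symm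
  rw [this, Complex.ofReal_zero] at hyr
  exact pow_ne_zero _ ht₁0 hyr

/-! ### The symmetrized disc in terms of zeros of polynomials -/

/-- The polynomial function `t ↦ 1 - c₁ t + c₂ t² - ⋯`, equal to `∏ (1 - zᵢ t)` if `c` is the
symmetrization of `z`. -/
noncomputable def reversedPoly {n : ℕ} (c : Fin n → ℂ) (t : ℂ) : ℂ :=
  1 + ∑ k : Fin n, (-1) ^ (k.val + 1) * c k * t ^ (k.val + 1)

/-- The weighted dilation `c ↦ (l c₁, l² c₂, …, lⁿ cₙ)`. -/
def weightedDilation {n : ℕ} (l : ℂ) (c : Fin n → ℂ) : Fin n → ℂ :=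
  fun k => l ^ (k.val + 1) * c k

theorem reversedPoly_weightedDilation {n : ℕ} (l : ℂ) (c : Fin n → ℂ) (t : ℂ) :
    reversedPoly (weightedDilation l c) t = reversedPoly c (l * t) := by
  simp only [reversedPoly, weightedDilation, mul_pow]
  congr 1
  exact Finset.sum_congr rfl fun k _ => by ring

theorem reversedPoly_symmetrization {n : ℕ} (z : Fin n → ℂ) (t : ℂ) :
    reversedPoly (symmetrization n z) t = ∏ i, (1 - z i * t) := by
  have h : ∏ i, (1 - z i * t) = ∏ i, (1 + (-t) * z i) :=
    Finset.prod_congr rfl fun i _ => by ring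
  rw [h, Finset.prod_one_add, Finset.sum_powerset, Finset.card_univ, Fintype.card_fin,
    Finset.sum_range_succ', add_comm, Finset.sum_range, reversedPoly]
  congr 1
  · simp
  · refine Finset.sum_congr rfl fun k _ => ?_
    rw [symmetrization, Finset.mul_sum, Finset.sum_mul]
    refine Finset.sum_congr rfl fun s hs => ?_
    rw [Finset.prod_mul_distrib, Finset.prod_const, (Finset.mem_powersetCard.1 hs).2, neg_pow]
    ring

theorem symmetrization_surjective (n : ℕ) : Function.Surjective (symmetrization n) := by
  intro c
  open Polynomial in
  set q : ℂ[X] := ∑ k : Fin n, C ((-1) ^ (k.val + 1) * c k) * X ^ (n - (k.val + 1)) with hq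
  have hqd : q.degree < n := by
    rw [hq, ← Polynomial.mem_degreeLT]
    refine Submodule.sum_mem _ fun k _ => Polynomial.mem_degreeLT.2 ?_
    refine (Polynomial.degree_C_mul_X_pow_le _ _).trans_lt ?_
    exact_mod_cast (by omega : n - (k.val + 1) < n)
  have hmonic : (Polynomial.X ^ n + q).Monic := Polynomial.monic_X_pow_add hqd
  have hdeg : (Polynomial.X ^ n + q).natDegree = n := Polynomial.natDegree_eq_of_degree_eq_some (by
    rw [Polynomial.degree_add_eq_left_of_degree_lt (by rwa [Polynomial.degree_X_pow]),
      Polynomial.degree_X_pow])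
  have hsplit := IsAlgClosed.splits (Polynomial.X ^ n + q)
  have hcard : (Polynomial.X ^ n + q).roots.card = n := by
    rw [← Polynomial.splits_iff_card_roots.1 hsplit |>.symm, hdeg]
  obtain ⟨z, hz⟩ : ∃ z : Fin n → ℂ, Multiset.map z Finset.univ.val = (Polynomial.X ^ n + q).roots := by
    generalize (Polynomial.X ^ n + q).roots = R at hcard
    subst hcard
    exact ⟨fun i => R.toList.get (i.cast (by simp)), by
      have : R = (R.toList : Multiset ℂ) := by simp
      conv_rhs => rw [this]
      rw [Fin.univ_val_map]
      congr 1
      refine List.ext_getElem (by simp) fun i h1 h2 => by simp⟩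
  refine ⟨z, funext fun k => ?_⟩
  have h := Polynomial.coeff_eq_esymm_roots_of_splits hsplit (k := n - (k.val + 1))
    (by rw [hdeg]; omega)
  rw [hmonic.leadingCoeff, hdeg, Nat.sub_sub_self (by omega), one_mul, ← hz, Finset.esymm_map_val,
    Polynomial.coeff_add, Polynomial.coeff_X_pow, if_neg (by omega), zero_add, hq,
    Polynomial.finsetSum_coeff, Finset.sum_eq_single k] at h
  · rw [Polynomial.coeff_C_mul_X_pow, if_pos rfl] at h
    exact (mul_left_cancel₀ (pow_ne_zero _ (by norm_num)) h).symm
  · intro j _ hj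
    rw [Polynomial.coeff_C_mul_X_pow, if_neg]
    have := Fin.val_ne_of_ne hj
    omega
  · simp

/-- The zeros of `∏ (1 - zᵢ t)` are the reciprocals of the nonzero `zᵢ`. -/
theorem mem_symmetrizedDisc_iff {n : ℕ} {c : Fin n → ℂ} :
    c ∈ symmetrizedDisc n ↔ ∀ t : ℂ, ‖t‖ ≤ 1 → reversedPoly c t ≠ 0 := by
  constructor
  · rintro ⟨z, hz, rfl⟩ t ht
    rw [reversedPoly_symmetrization]
    refine Finset.prod_ne_zero_iff.2 fun i _ h => ?_
    have h1 : ‖z i‖ < 1 := mem_ball_zero_iff.1 (hz i)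
    have h2 : ‖z i * t‖ = 1 := by rw [← sub_eq_zero.1 h, norm_one]
    rw [norm_mul] at h2
    nlinarith [norm_nonneg (z i), norm_nonneg t]
  · intro h
    obtain ⟨z, rfl⟩ := symmetrization_surjective n c
    refine ⟨z, fun i => mem_ball_zero_iff.2 ?_, rfl⟩
    by_contra! hzi
    have hz0 : z i ≠ 0 := norm_pos_iff.1 (one_pos.trans_le hzi)
    refine h (z i)⁻¹ (by rw [norm_inv]; exact inv_le_one_of_one_le₀ hzi) ?_
    rw [reversedPoly_symmetrization]
    exact Finset.prod_eq_zero (Finset.mem_univ i) (by rw [mul_inv_cancel₀ hz0, sub_self])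

theorem weightedDilation_mem_symmetrizedDisc {n : ℕ} {c : Fin n → ℂ} (hc : c ∈ symmetrizedDisc n)
    {l : ℂ} (hl : ‖l‖ ≤ 1) : weightedDilation l c ∈ symmetrizedDisc n := by
  rw [mem_symmetrizedDisc_iff] at hc ⊢
  intro t ht
  rw [reversedPoly_weightedDilation]
  exact hc _ (by rw [norm_mul]; exact mul_le_one₀ hl (norm_nonneg _) ht)

/-- If the weighted dilations of `h l` by the numbers `l` of modulus one, where `h` is holomorphic in a
neighbourhood of the closed disc, lie in the symmetrized disc, so does `h 0`. -/
theorem mem_symmetrizedDisc_of_sphere {n : ℕ} {h : ℂ → Fin n → ℂ}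
    (hd : DifferentiableOn ℂ h (closedBall 0 1))
    (hs : ∀ l ∈ sphere (0 : ℂ) 1, weightedDilation l (h l) ∈ symmetrizedDisc n) :
    h 0 ∈ symmetrizedDisc n := by
  rw [mem_symmetrizedDisc_iff]
  intro t ht
  have hcont : ContinuousOn (Function.uncurry fun (σ : ℝ) l => reversedPoly (h l) (σ * t))
      (Icc (0 : ℝ) 1 ×ˢ closedBall (0 : ℂ) 1) := by
    have hh : ∀ k, ContinuousOn (fun p : ℝ × ℂ => h p.2 k) (Icc (0 : ℝ) 1 ×ˢ closedBall (0 : ℂ) 1) :=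
      fun k => (continuousOn_pi.1 hd.continuousOn k).comp continuousOn_snd fun p hp => hp.2
    simp only [Function.uncurry_def, reversedPoly]
    refine continuousOn_const.add (continuousOn_finsetSum _ fun k _ => ?_)
    exact (continuousOn_const.mul (hh k)).mul (by fun_prop)
  -- The homotopy scales `t` by `σ`: at `σ = 0` the function is constantly `1`, and on `‖l‖ = 1` its
  -- value is that of the dilated point at `l⁻¹ σ t`.
  have := ne_zero_of_homotopy (F := fun (σ : ℝ) l => reversedPoly (h l) (σ * t)) hcont ?_ ?_ ?_
    one_pos (σ := 1) (by simp) (z := 0) (by simp)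
  · simpa using this
  · intro σ _
    simp only [reversedPoly]
    refine (DifferentiableOn.fun_sum fun k _ => ?_).const_add _
    exact ((differentiableOn_pi.1 hd k).const_mul _).mul_const _
  · intro z _
    simp [reversedPoly]
  · intro σ hσ l hl
    have h1 := mem_symmetrizedDisc_iff.1 (hs l hl) (l⁻¹ * (σ * t)) (by
      have hl1 : ‖l‖ = 1 := mem_sphere_zero_iff_norm.1 hl
      rw [norm_mul, norm_inv, hl1, norm_mul, Complex.norm_real, Real.norm_of_nonneg hσ.1]
      nlinarith [hσ.1, hσ.2, norm_nonneg t])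
    rw [reversedPoly_weightedDilation, mul_inv_cancel_left₀ (ne_of_mem_sphere hl one_ne_zero)] at h1
    exact h1

theorem differentiable_weightedDilation {n : ℕ} (c : Fin n → ℂ) :
    Differentiable ℂ fun l => weightedDilation l c := by
  unfold weightedDilation
  fun_prop

theorem weightedDilation_zero {n : ℕ} (c : Fin n → ℂ) : weightedDilation 0 c = 0 := by
  ext k
  simp [weightedDilation]

theorem weightedDilation_isBigO {n m : ℕ} {c : Fin n → ℂ} (hc : ∀ k, k.val + 1 < m → c k = 0) :
    (fun l => weightedDilation l c) =O[𝓝 0] fun l : ℂ => l ^ m := by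
  rw [isBigO_pi]
  intro k
  by_cases hk : k.val + 1 < m
  · simp only [weightedDilation, hc k hk, mul_zero]
    exact isBigO_zero _ _
  · have h1 : (fun l : ℂ => l ^ (k.val + 1)) =O[𝓝 0] fun l : ℂ => l ^ m :=
      IsBigO.of_bound 1 (by
        filter_upwards [closedBall_mem_nhds (0 : ℂ) one_pos] with l hl
        rw [norm_pow, norm_pow, one_mul]
        exact pow_le_pow_of_le_one (norm_nonneg _) (mem_closedBall_zero_iff.1 hl) (by omega))
    simp only [weightedDilation]
    simpa [mul_comm] using h1.const_mul_left (c k)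

/-! ### Convexity of the high-weight slice -/

/-- A convex combination, taken in a convex model `G` of `D'`, of two discs `l ↦ weightedDilation l a`,
`l ↦ weightedDilation l b` is tangent to the linear convex combination to order `n`, if the first
half of the coordinates of `a` and `b` vanish. -/
theorem exists_disc_of_convex_model {n : ℕ} {D' G : Set (Fin n → ℂ)} (hD : IsOpen D') (hG : IsOpen G)
    (hGc : Convex ℝ G) (hbi : Biholomorphic D' G) {a b : Fin n → ℂ}
    (ha : ∀ k : Fin n, 2 * (k.val + 1) ≤ n → a k = 0) (hb : ∀ k : Fin n, 2 * (k.val + 1) ≤ n → b k = 0)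
    (haD : ∀ l ∈ closedBall (0 : ℂ) 1, weightedDilation l a ∈ D')
    (hbD : ∀ l ∈ closedBall (0 : ℂ) 1, weightedDilation l b ∈ D')
    {α β : ℝ} (hα : 0 ≤ α) (hβ : 0 ≤ β) (hαβ : α + β = 1) :
    ∃ h : ℂ → Fin n → ℂ, DifferentiableOn ℂ h (closedBall 0 1) ∧ h 0 = α • a + β • b ∧
      ∀ l ∈ sphere (0 : ℂ) 1, weightedDilation l (h l) ∈ D' := by
  obtain ⟨f, g, hf, hg, hfm, hgm, hinv, -⟩ := hbi
  set s := α • a + β • b with hs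
  set γ : ℂ → Fin n → ℂ := fun l => weightedDilation l s with hγ
  set u : ℂ → Fin n → ℂ := fun l => α • f (weightedDilation l a) + β • f (weightedDilation l b) with hu
  have hda := differentiable_weightedDilation a
  have hdb := differentiable_weightedDilation b
  have hdγ : Differentiable ℂ γ := differentiable_weightedDilation s
  have hγ_eq : ∀ l, γ l = α • weightedDilation l a + β • weightedDilation l b := by
    intro l
    ext k
    simp only [hγ, hs, weightedDilation, Pi.add_apply, Pi.smul_apply, Complex.real_smul]
    ring
  have h0D : (0 : Fin n → ℂ) ∈ D' := by
    simpa [weightedDilation_zero] using haD 0 (by simp)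
  have hf0 : ∀ᶠ x in 𝓝 (0 : Fin n → ℂ), DifferentiableAt ℂ f x := by
    filter_upwards [hD.mem_nhds h0D] with x hx using hf.differentiableAt (hD.mem_nhds hx)
  have hg0 : ∀ᶠ x in 𝓝 (f 0), DifferentiableAt ℂ g x := by
    filter_upwards [hG.mem_nhds (hfm h0D)] with x hx using hg.differentiableAt (hG.mem_nhds hx)
  have hu_mem : ∀ l ∈ closedBall (0 : ℂ) 1, u l ∈ G := fun l hl =>
    hGc (hfm (haD l hl)) (hfm (hbD l hl)) hα hβ hαβ
  have hu_diff : ∀ l ∈ closedBall (0 : ℂ) 1, DifferentiableAt ℂ u l := by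
    intro l hl
    have h1 := (hf.differentiableAt (hD.mem_nhds (haD l hl))).comp l (hda l)
    have h2 := (hf.differentiableAt (hD.mem_nhds (hbD l hl))).comp l (hdb l)
    exact (h1.const_smul α).add (h2.const_smul β)
  have hv_diff : ∀ l ∈ closedBall (0 : ℂ) 1, DifferentiableAt ℂ (fun l => g (u l)) l :=
    fun l hl => (hg.differentiableAt (hG.mem_nhds (hu_mem l hl))).comp l (hu_diff l hl)
  have hu0 : u 0 = f 0 := by
    simp only [hu, weightedDilation_zero, ← add_smul, hαβ, one_smul]
  have hγ0 : γ 0 = 0 := weightedDilation_zero s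
  -- second order expansion of `f` along a disc vanishing to order more than `n / 2`
  obtain ⟨L, hL⟩ := exists_clm_sub_isBigO_sq hf0
  have hexp : ∀ c : Fin n → ℂ, (∀ k : Fin n, 2 * (k.val + 1) ≤ n → c k = 0) →
      (fun l => f (weightedDilation l c) - f 0 - L (weightedDilation l c)) =O[𝓝 0]
        fun l : ℂ => l ^ (n + 1) := by
    intro c hc
    have hlim : Tendsto (fun l => weightedDilation l c) (𝓝 0) (𝓝 0) := by
      simpa only [weightedDilation_zero] using (differentiable_weightedDilation c).continuous.tendsto 0
    have h1 := hL.comp_tendsto hlim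
    simp only [Function.comp_def, sub_zero] at h1
    -- Squaring gives order `2 (n / 2 + 1) ≥ n + 1`, for either parity of `n`.
    have h2 := (weightedDilation_isBigO (m := n / 2 + 1) fun k hk => hc k (by omega)).norm_left.pow 2
    refine (h1.trans h2).trans (IsBigO.of_bound 1 ?_)
    filter_upwards [closedBall_mem_nhds (0 : ℂ) one_pos] with l hl
    rw [← pow_mul, norm_pow, norm_pow, one_mul]
    exact pow_le_pow_of_le_one (norm_nonneg _) (mem_closedBall_zero_iff.1 hl) (by omega)
  have hs0 : ∀ k : Fin n, 2 * (k.val + 1) ≤ n → s k = 0 := fun k hk => by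
    simp [hs, ha k hk, hb k hk]
  have hdiff : (fun l => u l - f (γ l)) =O[𝓝 0] fun l : ℂ => l ^ (n + 1) := by
    have h1 := (((hexp a ha).const_smul_left α).add ((hexp b hb).const_smul_left β)).sub (hexp s hs0)
    refine h1.congr_left fun l => ?_
    have h2 : L (γ l) = α • L (weightedDilation l a) + β • L (weightedDilation l b) := by
      rw [hγ_eq, map_add]
      congr 1 <;> exact (L.restrictScalars ℝ).map_smul _ _
    change _ - (f (γ l) - f 0 - L (γ l)) = _
    have h3 : f 0 = α • f 0 + β • f 0 := by rw [← add_smul, hαβ, one_smul]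
    rw [h2]
    simp only [hu, Pi.smul_apply, smul_sub]
    nth_rewrite 3 [h3]
    abel
  have hgv : (fun l => g (u l) - γ l) =O[𝓝 0] fun l : ℂ => l ^ (n + 1) := by
    have hul : Tendsto u (𝓝 0) (𝓝 (f 0)) := by
      simpa only [hu0] using (hu_diff 0 (by simp)).continuousAt.tendsto
    have hγl : Tendsto γ (𝓝 0) (𝓝 0) := by
      simpa only [hγ0] using hdγ.continuous.tendsto 0
    have hfl : Tendsto (fun l => f (γ l)) (𝓝 0) (𝓝 (f 0)) :=
      hf0.self_of_nhds.continuousAt.tendsto.comp hγl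
    refine ((isBigO_sub_of_differentiable hg0 hul hfl).trans hdiff).congr' ?_ EventuallyEq.rfl
    filter_upwards [hγl (hD.mem_nhds h0D)] with l hl
    rw [hinv hl]
  -- Undo the dilation coordinatewise. The error `O(l^(n+1))` divided by `l^(k+1)` is `O(l^(n-k))`
  -- with `n - k ≥ 1`, so the singularity at `0` is removable with value `s`.
  set h : ℂ → Fin n → ℂ := Function.update (fun l k => g (u l) k / l ^ (k.val + 1)) 0 s with hh
  have hne : ∀ l, l ≠ 0 → h l = fun k => g (u l) k / l ^ (k.val + 1) := fun l hl =>
    Function.update_of_ne hl _ _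
  have hh0 : h 0 = s := Function.update_self _ _ _
  refine ⟨h, ?_, hh0, ?_⟩
  · rw [← Complex.differentiableOn_compl_singleton_and_continuousAt_iff
      (closedBall_mem_nhds (0 : ℂ) one_pos)]
    constructor
    · rintro l ⟨hl, hl0⟩
      replace hl0 : l ≠ 0 := hl0
      refine DifferentiableAt.differentiableWithinAt ?_
      have h1 : DifferentiableAt ℂ (fun l k => g (u l) k / l ^ ((k : Fin n).val + 1)) l :=
        differentiableAt_pi.2 fun k => (differentiableAt_pi.1 (hv_diff l hl) k).div
          (differentiableAt_id.pow _) (pow_ne_zero _ hl0)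
      refine h1.congr_of_eventuallyEq ?_
      filter_upwards [isOpen_ne.mem_nhds hl0] with w hw using hne w hw
    · rw [continuousAt_update_same, tendsto_pi_nhds]
      intro k
      have h1 : (fun l => g (u l) k - γ l k) =O[𝓝[≠] 0] fun l : ℂ => l ^ (n + 1) :=
        (isBigO_pi.1 hgv k).mono nhdsWithin_le_nhds
      have h2 : (fun l => (g (u l) k - γ l k) / l ^ (k.val + 1)) =O[𝓝[≠] 0]
          fun l : ℂ => l ^ (n - k.val) := by
        refine (h1.mul (isBigO_refl (fun l : ℂ => (l ^ (k.val + 1))⁻¹) _)).congr' ?_ ?_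
        · exact Eventually.of_forall fun l => (div_eq_mul_inv _ _).symm
        · filter_upwards [self_mem_nhdsWithin] with l hl
          have : n + 1 = (n - k.val) + (k.val + 1) := by omega
          rw [this, pow_add, mul_inv_cancel_right₀ (pow_ne_zero _ hl)]
      have h3 : Tendsto (fun l : ℂ => l ^ (n - k.val)) (𝓝[≠] 0) (𝓝 0) := by
        have : Tendsto (fun l : ℂ => l ^ (n - k.val)) (𝓝 0) (𝓝 (0 ^ (n - k.val))) :=
          (continuous_pow _).tendsto 0
        rw [zero_pow (by omega)] at this
        exact this.mono_left nhdsWithin_le_nhds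
      have h4 := (h2.trans_tendsto h3).add_const (s k)
      rw [zero_add] at h4
      refine h4.congr' ?_
      filter_upwards [self_mem_nhdsWithin] with l hl
      have : l ^ (k.val + 1) ≠ 0 := pow_ne_zero _ hl
      simp only [hγ, weightedDilation]
      field_simp
      ring
  · intro l hl
    have hl0 : l ≠ 0 := ne_of_mem_sphere hl one_ne_zero
    have : weightedDilation l (h l) = g (u l) := by
      ext k
      rw [weightedDilation, hne l hl0, mul_div_cancel₀ _ (pow_ne_zero _ hl0)]
    rw [this]
    exact hgm (hu_mem l (sphere_subset_closedBall hl))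

theorem convex_slice_of_exhausted {n : ℕ} (hex : ExhaustedByBiholomorphicToConvex (symmetrizedDisc n)) :
    Convex ℝ {c ∈ symmetrizedDisc n | ∀ k : Fin n, 2 * (k.val + 1) ≤ n → c k = 0} := by
  rintro a ⟨haG, ha⟩ b ⟨hbG, hb⟩ α β hα hβ hαβ
  refine ⟨?_, fun k hk => by simp [ha k hk, hb k hk]⟩
  have hK : ∀ c : Fin n → ℂ, IsCompact ((fun l => weightedDilation l c) '' closedBall 0 1) := fun c =>
    (isCompact_closedBall 0 1).image (differentiable_weightedDilation c).continuous
  obtain ⟨D', hD', hKD, hDG, G, hG, hGc, hbi⟩ := hex _ ((hK a).union (hK b)) (by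
    rintro _ (⟨l, hl, rfl⟩ | ⟨l, hl, rfl⟩)
    · exact weightedDilation_mem_symmetrizedDisc haG (mem_closedBall_zero_iff.1 hl)
    · exact weightedDilation_mem_symmetrizedDisc hbG (mem_closedBall_zero_iff.1 hl))
  obtain ⟨h, hd, h0, hs⟩ := exists_disc_of_convex_model hD'.1 hG.1 hGc hbi ha hb
    (fun l hl => hKD (Or.inl ⟨l, hl, rfl⟩)) (fun l hl => hKD (Or.inr ⟨l, hl, rfl⟩)) hα hβ hαβ
  rw [← h0]
  exact mem_symmetrizedDisc_of_sphere hd fun l hl => hDG (hs l hl)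

/-! ### Trinomials inside the slice and the conclusion -/

/-- The point whose `reversedPoly` is `1 + A t ^ (N + 1) + B t ^ (N + 2)`. -/
def trinomialPoint (N : ℕ) : ℂ × ℂ →ₗ[ℝ] (Fin (N + 2) → ℂ) where
  toFun p := fun k => if k.val = N then (-1) ^ (N + 1) * p.1
    else if k.val = N + 1 then (-1) ^ (N + 2) * p.2 else 0
  map_add' p q := by
    ext k
    simp only [Pi.add_apply, Prod.fst_add, Prod.snd_add]
    split_ifs <;> ring
  map_smul' r p := by
    ext k
    simp only [Pi.smul_apply, Prod.smul_fst, Prod.smul_snd, RingHom.id_apply]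
    split_ifs <;> simp <;> ring

theorem reversedPoly_trinomialPoint (N : ℕ) (p : ℂ × ℂ) (t : ℂ) :
    reversedPoly (trinomialPoint N p) t = 1 + p.1 * t ^ (N + 1) + p.2 * t ^ (N + 2) := by
  have h1 : ∀ m : ℕ, ((-1 : ℂ) ^ m) * (-1) ^ m = 1 := fun m => by rw [← mul_pow]; simp
  rw [reversedPoly, Fin.sum_univ_castSucc, Fin.sum_univ_castSucc, Finset.sum_eq_zero]
  · simp only [trinomialPoint, LinearMap.coe_mk, AddHom.coe_mk, Fin.val_castSucc, Fin.val_last,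
      if_true, if_neg (Nat.succ_ne_self N)]
    linear_combination p.1 * t ^ (N + 1) * h1 (N + 1) + p.2 * t ^ (N + 2) * h1 (N + 2)
  · intro k _
    have := k.isLt
    simp only [trinomialPoint, LinearMap.coe_mk, AddHom.coe_mk, Fin.val_castSucc]
    rw [if_neg (by omega), if_neg (by omega)]
    simp

theorem proposition3 (n : ℕ) (hn : 3 ≤ n) :
    ¬ ExhaustedByBiholomorphicToConvex (symmetrizedDisc n) := by
  intro hex
  obtain ⟨N, rfl⟩ : ∃ N, n = N + 2 := Nat.exists_eq_add_of_le' (by omega)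
  have hpre : zeroFreeTrinomials (N + 1) = trinomialPoint N ⁻¹'
      {c ∈ symmetrizedDisc (N + 2) | ∀ k : Fin (N + 2), 2 * (k.val + 1) ≤ N + 2 → c k = 0} := by
    ext p
    simp only [zeroFreeTrinomials, mem_ofPred_eq, mem_preimage, mem_symmetrizedDisc_iff,
      reversedPoly_trinomialPoint, iff_self_and]
    intro _ k hk
    simp only [trinomialPoint, LinearMap.coe_mk, AddHom.coe_mk]
    -- This is where `n ≥ 3` enters: the weights `n - 1` and `n` both exceed `n/2`.
    rw [if_neg (by omega), if_neg (by omega)]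
  have hconv := (convex_slice_of_exhausted hex).linear_preimage (trinomialPoint N)
  rw [← hpre] at hconv
  exact not_convex_zeroFreeTrinomials N.succ_pos hconv
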